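/- Let $\mathrm{BL}_{\mathrm{AIPLH}}$ be the category whose objects are the real Banach lattices and whose morphisms are the linear lattice homomorphisms $\varphi\colon E\to F$ that are contractive ($\|\varphi(x)\|\le\|x\|$ for all $x\in E$) and almost interval preserving, i.e. positive with $[0,\varphi(x)]_F=\overline{\varphi([0,x]_E)}$ (norm closure) for all $x\in E$ with $x\ge 0$. Let $I$ be a non-empty directed set, and let $\bigl((E_i)_{i\in I},(\varphi_{ji})_{j\ge i}\bigr)$ be a direct system in $\mathrm{BL}_{\mathrm{AIPLH}}$ over $I$: the $E_i$ are Banach lattices and the $\varphi_{ji}\colon E_i\to E_j$ ($j\ge i$) are morphisms with $\varphi_{ii}=\mathrm{id}_{E_i}$ and $\varphi_{kj}\circ\varphi_{ji}=\varphi_{ki}$ for $i\le j\le k$. A direct limit of the system in $\mathrm{BL}_{\mathrm{AIPLH}}$ is a Banach lattice $E$ with morphisms $\varphi_i\colon E_i\to E$ such that $\varphi_j\circ\varphi_{ji}=\varphi_i$ for all $j\ge i$, and such that for every Banach lattice $E'$ and all morphisms $\varphi_i'\colon E_i\to E'$ with $\varphi_j'\circ\varphi_{ji}=\varphi_i'$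 for all $j\ge i$ there is a unique morphism $\chi\colon E\to E'$ with $\chi\circ\varphi_i=\varphi_i'$ for all $i$. A Banach lattice is order continuous if $\|x_\alpha\|\to 0$ for every decreasing net $(x_\alpha)$ in it with infimum $0$. Theorem. The direct system has a direct limit in $\mathrm{BL}_{\mathrm{AIPLH}}$. If all $E_i$ are order continuous, and $\bigl(E,(\varphi_i)_{i\in I}\bigr)$ is any direct limit of the system in $\mathrm{BL}_{\mathrm{AIPLH}}$, then $E$ is order continuous. -/

import Mathlib

open CategoryTheory CategoryTheory.Limits Filter Topology

universe u v

/-- A positive linear map `φ : E → F` is almost interval preserving when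
`[0, φ x]` is the norm closure of `φ [0, x]`, for every `x ≥ 0`. -/
def IsAlmostIntervalPreserving {E F : Type*} [NormedAddCommGroup E] [NormedSpace ℝ E] [Lattice E]
    [NormedAddCommGroup F] [NormedSpace ℝ F] [Lattice F] (φ : E →ₗ[ℝ] F) : Prop :=
  (∀ x : E, 0 ≤ x → 0 ≤ φ x) ∧
    ∀ x : E, 0 ≤ x → Set.Icc 0 (φ x) = closure (φ '' Set.Icc 0 x)

/-- The norm is order continuous: `‖x_a‖ → 0` for every net `x_a ↓ 0`, that is, for every
decreasing net with infimum `0`. -/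
def IsOrderContinuousNorm (E : Type u) [NormedAddCommGroup E] [Lattice E] : Prop :=
  ∀ (A : Type u) [Preorder A] [IsDirectedOrder A] [Nonempty A] (x : A → E),
    Antitone x → IsGLB (Set.range x) 0 → Tendsto (fun a => ‖x a‖) atTop (𝓝 0)

/-- Objects of the category: (real) Banach lattices. A direct system in the category over a directed
set `I` is a functor `I ⥤ BLAIPLH`, with `I` seen as a category, a compatible system is a `Cocone`
of this functor, and a direct limit is a `Cocone` with `IsColimit`. -/
structure BLAIPLH : Type (u + 1) where
  carrier : Type u
  [normedAddCommGroup : NormedAddCommGroup carrier]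
  [normedSpace : NormedSpace ℝ carrier]
  [lattice : Lattice carrier]
  [isOrderedAddMonoid : IsOrderedAddMonoid carrier]
  [isOrderedModule : IsOrderedModule ℝ carrier]
  [hasSolidNorm : HasSolidNorm carrier]
  [completeSpace : CompleteSpace carrier]

namespace BLAIPLH

instance : CoeSort BLAIPLH.{u} (Type u) := ⟨BLAIPLH.carrier⟩

attribute [instance] normedAddCommGroup normedSpace lattice isOrderedAddMonoid isOrderedModule
  hasSolidNorm completeSpace

/-- Morphisms of the category: contractive almost interval preserving vector lattice
homomorphisms. -/
@[ext]
structure Hom (E F : BLAIPLH.{u}) : Type u where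
  toLinearMap : E →ₗ[ℝ] F
  map_sup : ∀ x y : E, toLinearMap (x ⊔ y) = toLinearMap x ⊔ toLinearMap y
  map_inf : ∀ x y : E, toLinearMap (x ⊓ y) = toLinearMap x ⊓ toLinearMap y
  norm_map_le : ∀ x : E, ‖toLinearMap x‖ ≤ ‖x‖
  almostIntervalPreserving : IsAlmostIntervalPreserving toLinearMap

theorem isAlmostIntervalPreserving_id (E : BLAIPLH.{u}) :
    IsAlmostIntervalPreserving (LinearMap.id : E →ₗ[ℝ] E) :=
  ⟨fun _ hx => hx, fun x _ => by simp [isClosed_Icc.closure_eq]⟩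

theorem isAlmostIntervalPreserving_comp {E F G : BLAIPLH.{u}} (f : Hom E F) (g : Hom F G) :
    IsAlmostIntervalPreserving (g.toLinearMap ∘ₗ f.toLinearMap) := by
  have hg : Continuous g.toLinearMap :=
    (g.toLinearMap.mkContinuous 1 (by simpa using g.norm_map_le)).continuous
  refine ⟨fun x hx => g.almostIntervalPreserving.1 _ (f.almostIntervalPreserving.1 _ hx),
    fun x hx => ?_⟩
  have h1 := f.almostIntervalPreserving.2 x hx
  have h2 := g.almostIntervalPreserving.2 _ (f.almostIntervalPreserving.1 _ hx)
  rw [LinearMap.comp_apply, h2, h1, closure_image_closure hg, LinearMap.coe_comp, Set.image_comp]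

instance instCategory : Category BLAIPLH.{u} where
  Hom := Hom
  id E :=
    { toLinearMap := LinearMap.id
      map_sup := fun _ _ => rfl
      map_inf := fun _ _ => rfl
      norm_map_le := fun _ => le_rfl
      almostIntervalPreserving := isAlmostIntervalPreserving_id E }
  comp f g :=
    { toLinearMap := g.toLinearMap ∘ₗ f.toLinearMap
      map_sup := fun x y => by simp [f.map_sup, g.map_sup]
      map_inf := fun x y => by simp [f.map_inf, g.map_inf]
      norm_map_le := fun x => (g.norm_map_le _).trans (f.norm_map_le x)
      almostIntervalPreserving := isAlmostIntervalPreserving_comp f g }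

end BLAIPLH

/-! Existence: eventually coherent families form a vector lattice under pointwise operations, and
the limit of the norms of the members is a solid seminorm. Its Hausdorff completion identifies
families that differ by a null family and is a Banach lattice, in which the images of the `E_i` are
dense. Since lattice operations are nonexpansive in each argument, approximants can be cut back into
order intervals. This density argument shows that the canonical maps
(`isAlmostIntervalPreserving_toLimit`) and the maps induced by cocones
(`isAlmostIntervalPreserving_limitDesc`) are almost interval preserving. Density also gives
uniqueness.

Order continuity: for Banach lattices it is equivalent to every increasing sequence in an order
interval `[0, x]` being norm Cauchy. This property of `x` passes from `x ≥ 0` to its image under a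
morphism (`monotoneCauchyBelow_lin`, the main step) and to norm limits
(`MonotoneCauchyBelow.of_forall_exists_norm_sub_lt`). As any direct limit is isomorphic to the
constructed one, its images are dense, and every positive element inherits the property. -/

/-- A seminorm on a lattice ordered group is solid if `|x| ≤ |y|` implies `‖x‖ ≤ ‖y‖`. -/
class HasSolidSeminorm (V : Type*) [SeminormedAddCommGroup V] [Lattice V] : Prop where
  solid : ∀ ⦃x y : V⦄, |x| ≤ |y| → ‖x‖ ≤ ‖y‖

/-! ### Banach lattice structure on the completion of a solidly seminormed vector lattice -/

section CompletionLattice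

open UniformSpace

variable {V : Type*} [SeminormedAddCommGroup V] [Lattice V] [IsOrderedAddMonoid V]
  [HasSolidSeminorm V]

theorem abs_sup_sub_sup_le_add_abs {G : Type*} [AddCommGroup G] [Lattice G] [IsOrderedAddMonoid G]
    (a b c d : G) : |a ⊔ b - c ⊔ d| ≤ |a - c| + |b - d| := by
  calc |a ⊔ b - c ⊔ d| = |(a ⊔ b - c ⊔ b) + (b ⊔ c - d ⊔ c)| := by
        rw [sup_comm b c, sup_comm d c, sub_add_sub_cancel]
    _ ≤ |a ⊔ b - c ⊔ b| + |b ⊔ c - d ⊔ c| := abs_add_le _ _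
    _ ≤ |a - c| + |b - d| :=
        add_le_add (abs_sup_sub_sup_le_abs _ _ _) (abs_sup_sub_sup_le_abs _ _ _)

theorem abs_inf_sub_inf_le_add_abs {G : Type*} [AddCommGroup G] [Lattice G] [IsOrderedAddMonoid G]
    (a b c d : G) : |a ⊓ b - c ⊓ d| ≤ |a - c| + |b - d| := by
  calc |a ⊓ b - c ⊓ d| = |(a ⊓ b - c ⊓ b) + (b ⊓ c - d ⊓ c)| := by
        rw [inf_comm b c, inf_comm d c, sub_add_sub_cancel]
    _ ≤ |a ⊓ b - c ⊓ b| + |b ⊓ c - d ⊓ c| := abs_add_le _ _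
    _ ≤ |a - c| + |b - d| :=
        add_le_add (abs_inf_sub_inf_le_abs _ _ _) (abs_inf_sub_inf_le_abs _ _ _)

namespace HasSolidSeminorm

theorem norm_abs (x : V) : ‖|x|‖ = ‖x‖ :=
  (solid (abs_abs x).le).antisymm (solid (abs_abs x).ge)

theorem norm_le_add_of_abs_le_add_abs {x y z : V} (h : |x| ≤ |y| + |z|) : ‖x‖ ≤ ‖y‖ + ‖z‖ := by
  have h' : |x| ≤ |(|y| + |z|)| := h.trans (le_abs_self _)
  calc ‖x‖ ≤ ‖|y| + |z|‖ := solid h'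
    _ ≤ ‖|y|‖ + ‖|z|‖ := norm_add_le _ _
    _ = ‖y‖ + ‖z‖ := by rw [norm_abs, norm_abs]

/-- Joint uniform continuity is what lets `⊔` and `⊓` extend to the completion. -/
theorem uniformContinuous₂_of_abs_le {f : V → V → V}
    (hf : ∀ a b c d, |f a b - f c d| ≤ |a - c| + |b - d|) : UniformContinuous₂ f := by
  refine Metric.uniformContinuous_iff.2 fun ε hε => ⟨ε / 2, half_pos hε, fun {p q} hpq => ?_⟩
  have h := norm_le_add_of_abs_le_add_abs (hf p.1 p.2 q.1 q.2)
  rw [Prod.dist_eq, max_lt_iff, dist_eq_norm, dist_eq_norm] at hpq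
  rw [dist_eq_norm]
  exact h.trans_lt (by linarith [hpq.1, hpq.2])

theorem uniformContinuous₂_sup : UniformContinuous₂ (fun a b : V => a ⊔ b) :=
  uniformContinuous₂_of_abs_le abs_sup_sub_sup_le_add_abs

theorem uniformContinuous₂_inf : UniformContinuous₂ (fun a b : V => a ⊓ b) :=
  uniformContinuous₂_of_abs_le abs_inf_sub_inf_le_add_abs

end HasSolidSeminorm

open HasSolidSeminorm

namespace UniformSpace.Completion

noncomputable instance instMaxOfSolid : Max (Completion V) := ⟨Completion.map₂ (· ⊔ ·)⟩

noncomputable instance instMinOfSolid : Min (Completion V) := ⟨Completion.map₂ (· ⊓ ·)⟩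

@[norm_cast]
theorem coe_sup (a b : V) : ((a ⊔ b : V) : Completion V) = (a : Completion V) ⊔ b :=
  (map₂_coe_coe a b _ uniformContinuous₂_sup).symm

@[norm_cast]
theorem coe_inf (a b : V) : ((a ⊓ b : V) : Completion V) = (a : Completion V) ⊓ b :=
  (map₂_coe_coe a b _ uniformContinuous₂_inf).symm

instance : ContinuousSup (Completion V) :=
  ⟨continuous_map₂ (f := fun a b : V => a ⊔ b) continuous_fst continuous_snd⟩

instance : ContinuousInf (Completion V) :=
  ⟨continuous_map₂ (f := fun a b : V => a ⊓ b) continuous_fst continuous_snd⟩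

/-- The order is defined through the lattice identities. These are closed conditions, so they extend
from the dense image of `V`. -/
noncomputable instance instLatticeOfSolid : Lattice (Completion V) :=
  Lattice.mk'
    (fun a b => induction_on₂ a b (isClosed_eq (by fun_prop) (by fun_prop))
      fun a b => by rw [← coe_sup, ← coe_sup, sup_comm])
    (fun a b c => induction_on₃ a b c (isClosed_eq (by fun_prop) (by fun_prop))
      fun a b c => by rw [← coe_sup, ← coe_sup, ← coe_sup, ← coe_sup, sup_assoc])
    (fun a b => induction_on₂ a b (isClosed_eq (by fun_prop) (by fun_prop))
      fun a b => by rw [← coe_inf, ← coe_inf, inf_comm])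
    (fun a b c => induction_on₃ a b c (isClosed_eq (by fun_prop) (by fun_prop))
      fun a b c => by rw [← coe_inf, ← coe_inf, ← coe_inf, ← coe_inf, inf_assoc])
    (fun a b => induction_on₂ a b (isClosed_eq (by fun_prop) (by fun_prop))
      fun a b => by rw [← coe_inf, ← coe_sup, sup_inf_self])
    (fun a b => induction_on₂ a b (isClosed_eq (by fun_prop) (by fun_prop))
      fun a b => by rw [← coe_sup, ← coe_inf, inf_sup_self])

theorem sup_add_of_solid (a b c : Completion V) : a ⊔ b + c = (a + c) ⊔ (b + c) :=
  induction_on₃ a b c (isClosed_eq (by fun_prop) (by fun_prop))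
    fun a b c => by rw [← coe_sup, ← coe_add, ← coe_add, ← coe_add, ← coe_sup, sup_add]

instance instIsOrderedAddMonoidOfSolid : IsOrderedAddMonoid (Completion V) where
  add_le_add_left a b h c := by
    rw [← sup_eq_right] at h ⊢
    rw [← sup_add_of_solid, h]

theorem norm_abs_of_solid (a : Completion V) : ‖|a|‖ = ‖a‖ := by
  unfold abs
  exact induction_on a (isClosed_eq (by fun_prop) (by fun_prop))
    fun a => by rw [← coe_neg, ← coe_sup, norm_coe, norm_coe]; exact norm_abs a

/-- An unconditional form of solidity: the premise `|a| ≤ |b|` need not survive approximation by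
elements of `V`, whereas this inequality is a closed condition on all pairs. -/
theorem norm_abs_inf_abs_le (a b : Completion V) : ‖|a| ⊓ |b|‖ ≤ ‖b‖ := by
  unfold abs
  refine induction_on₂ a b (isClosed_le (by fun_prop) (by fun_prop)) fun a b => ?_
  rw [← coe_neg, ← coe_neg, ← coe_sup, ← coe_sup, ← coe_inf, norm_coe, norm_coe]
  refine solid ?_
  change |(|a| ⊓ |b|)| ≤ |b|
  rw [abs_of_nonneg (le_inf (abs_nonneg a) (abs_nonneg b))]
  exact inf_le_right

instance instHasSolidNormOfSolid : HasSolidNorm (Completion V) where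
  solid a b h := by
    have := norm_abs_inf_abs_le a b
    rwa [inf_eq_left.2 h, norm_abs_of_solid] at this

variable [NormedSpace ℝ V] [IsOrderedModule ℝ V]

theorem smul_sup_of_solid {r : ℝ} (hr : 0 ≤ r) (a b : Completion V) :
    r • (a ⊔ b) = r • a ⊔ r • b := by
  have hV : ∀ a b : V, r • (a ⊔ b) = r • a ⊔ r • b := fun a b => by
    rcases hr.eq_or_lt with rfl | hr
    · simp
    · exact (OrderIso.smulRight (β := V) hr).map_sup a b
  refine induction_on₂ a b (isClosed_eq ?_ ?_) fun a b => ?_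
  · exact (continuous_fst.sup continuous_snd).const_smul r
  · exact (continuous_fst.const_smul r).sup (continuous_snd.const_smul r)
  · rw [← coe_sup, ← coe_smul, ← coe_smul, ← coe_smul, ← coe_sup, hV]

instance instIsOrderedModuleOfSolid : IsOrderedModule ℝ (Completion V) :=
  haveI : PosSMulMono ℝ (Completion V) := ⟨fun r hr a b h => by
    rw [← sup_eq_right] at h ⊢
    rw [← smul_sup_of_solid hr, h]⟩
  { smul_le_smul_of_nonneg_right := fun a ha r s h => by
      rw [← sub_nonneg, ← sub_smul]
      exact smul_nonneg (sub_nonneg.2 h) ha }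

end UniformSpace.Completion

end CompletionLattice

namespace BLAIPLH

/-! ### Morphisms and the approximation form of almost interval preservation -/

section Morphisms

variable {E F G : BLAIPLH.{u}}

/-- The linear map underlying a morphism. -/
def lin (f : E ⟶ F) : E →ₗ[ℝ] F := Hom.toLinearMap f

theorem lin_comp (f : E ⟶ F) (g : F ⟶ G) (x : E) : lin (f ≫ g) x = lin g (lin f x) := rfl

theorem lin_id (x : E) : lin (𝟙 E) x = x := rfl

theorem hom_ext {f g : E ⟶ F} (h : ∀ x, lin f x = lin g x) : f = g :=
  Hom.ext (LinearMap.ext h)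

theorem lin_sup (f : E ⟶ F) (x y : E) : lin f (x ⊔ y) = lin f x ⊔ lin f y := Hom.map_sup f x y

theorem lin_inf (f : E ⟶ F) (x y : E) : lin f (x ⊓ y) = lin f x ⊓ lin f y := Hom.map_inf f x y

theorem norm_lin_le (f : E ⟶ F) (x : E) : ‖lin f x‖ ≤ ‖x‖ := Hom.norm_map_le f x

theorem norm_lin_sub_le (f : E ⟶ F) (x y : E) : ‖lin f x - lin f y‖ ≤ ‖x - y‖ := by
  rw [← map_sub]
  exact norm_lin_le f _

theorem lin_nonneg (f : E ⟶ F) {x : E} (hx : 0 ≤ x) : 0 ≤ lin f x :=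
  (Hom.almostIntervalPreserving f).1 x hx

theorem exists_norm_sub_lin_lt (f : E ⟶ F) {x : E} (hx : 0 ≤ x) {y : F} (hy : 0 ≤ y)
    (hyx : y ≤ lin f x) {ε : ℝ} (hε : 0 < ε) :
    ∃ z, 0 ≤ z ∧ z ≤ x ∧ ‖y - lin f z‖ < ε := by
  have h : y ∈ closure (lin f '' Set.Icc 0 x) :=
    (Hom.almostIntervalPreserving f).2 x hx ▸ ⟨hy, hyx⟩
  obtain ⟨_, ⟨z, hz, rfl⟩, hzy⟩ := Metric.mem_closure_iff.1 h ε hε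
  exact ⟨z, hz.1, hz.2, by rwa [← dist_eq_norm]⟩

/-- A lattice homomorphism is almost interval preserving if all elements of the order intervals
`[0, φ x]` are limits of elements of `φ [0, x]`. -/
theorem isAlmostIntervalPreserving_of_exists {φ : E →ₗ[ℝ] F}
    (hsup : ∀ x y, φ (x ⊔ y) = φ x ⊔ φ y)
    (h : ∀ x, 0 ≤ x → ∀ y, 0 ≤ y → y ≤ φ x → ∀ ε > 0, ∃ z, 0 ≤ z ∧ z ≤ x ∧ ‖y - φ z‖ < ε) :
    IsAlmostIntervalPreserving φ := by
  have hpos : ∀ x : E, 0 ≤ x → 0 ≤ φ x := fun x hx => by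
    have := hsup 0 x
    rw [sup_eq_right.2 hx, map_zero] at this
    exact sup_eq_right.1 this.symm
  refine ⟨hpos, fun x hx => Set.Subset.antisymm (fun y hy => Metric.mem_closure_iff.2 ?_) ?_⟩
  · intro ε hε
    obtain ⟨z, hz, hzx, hyz⟩ := h x hx y hy.1 hy.2 ε hε
    exact ⟨φ z, ⟨z, ⟨hz, hzx⟩, rfl⟩, by rwa [dist_eq_norm]⟩
  · refine closure_minimal ?_ isClosed_Icc
    rintro _ ⟨z, hz, rfl⟩
    refine ⟨hpos z hz.1, ?_⟩
    have := hpos (x - z) (sub_nonneg.2 hz.2)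
    rwa [map_sub, sub_nonneg] at this

end Morphisms

/-! ### The seminormed vector lattice of eventually coherent families -/

section System

variable {I : Type v} [Preorder I] (E : I ⥤ BLAIPLH.{max u v})

/-- The connecting maps of a direct system. -/
def trans {i j : I} (h : i ≤ j) : E.obj i →ₗ[ℝ] E.obj j := lin (E.map (homOfLE h))

theorem trans_self {i : I} (x : E.obj i) : trans E le_rfl x = x := by
  have : E.map (homOfLE (le_refl i)) = 𝟙 _ := E.map_id i
  rw [trans, this, lin_id]

theorem trans_trans {i j k : I} (hij : i ≤ j) (hjk : j ≤ k) (x : E.obj i) :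
    trans E hjk (trans E hij x) = trans E (hij.trans hjk) x := by
  have : E.map (homOfLE (hij.trans hjk)) = E.map (homOfLE hij) ≫ E.map (homOfLE hjk) :=
    E.map_comp (homOfLE hij) (homOfLE hjk)
  rw [trans, trans, trans, this, lin_comp]

/-- The family `x` is coherent from the index `i` on. -/
def CoherentFrom (x : ∀ i, E.obj i) (i : I) : Prop := ∀ j (h : i ≤ j), x j = trans E h (x i)

variable {E} in
theorem CoherentFrom.mono {x : ∀ i, E.obj i} {i j : I} (hx : CoherentFrom E x i) (h : i ≤ j) :
    CoherentFrom E x j := fun k hk => by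
  rw [hx k (h.trans hk), hx j h, trans_trans]

variable [IsDirectedOrder I] [Nonempty I]

/-- The eventually coherent families of a direct system. -/
def eventuallyCoherent : Submodule ℝ (∀ i, E.obj i) where
  carrier := {x | ∃ i, CoherentFrom E x i}
  zero_mem' := ⟨Classical.arbitrary I, fun j h => by simp⟩
  add_mem' := by
    rintro x y ⟨i, hx⟩ ⟨j, hy⟩
    obtain ⟨k, hik, hjk⟩ := exists_ge_ge i j
    exact ⟨k, fun l h => by simp [hx.mono hik l h, hy.mono hjk l h]⟩
  smul_mem' := by
    rintro r x ⟨i, hx⟩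
    exact ⟨i, fun l h => by simp [hx l h]⟩

/-- The algebraic direct limit before passing to the quotient: eventually coherent families, to be
seminormed by the limit of the norms of the members. -/
def PreLimit : Type (max u v) := eventuallyCoherent E

namespace PreLimit

instance : AddCommGroup (PreLimit E) := inferInstanceAs (AddCommGroup (eventuallyCoherent E))

instance : Module ℝ (PreLimit E) := inferInstanceAs (Module ℝ (eventuallyCoherent E))

variable {E}

theorem exists_coherentFrom (x : PreLimit E) : ∃ i, CoherentFrom E x.1 i := x.2

theorem exists_coherentFrom₂ (x y : PreLimit E) :
    ∃ i, CoherentFrom E x.1 i ∧ CoherentFrom E y.1 i := by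
  obtain ⟨i, hx⟩ := x.2
  obtain ⟨j, hy⟩ := y.2
  obtain ⟨k, hik, hjk⟩ := exists_ge_ge i j
  exact ⟨k, hx.mono hik, hy.mono hjk⟩

instance : Lattice (PreLimit E) :=
  Subtype.lattice (P := fun x => x ∈ eventuallyCoherent E)
    (fun {x y} hx hy => by
      obtain ⟨k, h₁, h₂⟩ := exists_coherentFrom₂ ⟨x, hx⟩ ⟨y, hy⟩
      exact ⟨k, fun l h => by
        exact (congrArg₂ _ (h₁ l h) (h₂ l h)).trans (lin_sup _ _ _).symm⟩)
    (fun {x y} hx hy => by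
      obtain ⟨k, h₁, h₂⟩ := exists_coherentFrom₂ ⟨x, hx⟩ ⟨y, hy⟩
      exact ⟨k, fun l h => by
        exact (congrArg₂ _ (h₁ l h) (h₂ l h)).trans (lin_inf _ _ _).symm⟩)

theorem add_apply (x y : PreLimit E) (i : I) : (x + y).1 i = x.1 i + y.1 i := rfl

theorem sub_apply (x y : PreLimit E) (i : I) : (x - y).1 i = x.1 i - y.1 i := rfl

theorem neg_apply (x : PreLimit E) (i : I) : (-x).1 i = -x.1 i := rfl

theorem zero_apply (i : I) : (0 : PreLimit E).1 i = 0 := rfl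

theorem smul_apply (r : ℝ) (x : PreLimit E) (i : I) : (r • x).1 i = r • x.1 i := rfl

theorem sup_apply (x y : PreLimit E) (i : I) : (x ⊔ y).1 i = x.1 i ⊔ y.1 i := rfl

theorem inf_apply (x y : PreLimit E) (i : I) : (x ⊓ y).1 i = x.1 i ⊓ y.1 i := rfl

instance : IsOrderedAddMonoid (PreLimit E) where
  add_le_add_left _ _ h c i := add_le_add_left (h i) (c.1 i)

instance : IsOrderedModule ℝ (PreLimit E) where
  smul_le_smul_of_nonneg_left _ hr _ _ h i := smul_le_smul_of_nonneg_left (h i) hr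
  smul_le_smul_of_nonneg_right _ hx _ _ h i := smul_le_smul_of_nonneg_right h (hx i)

/-- Contractivity of the connecting maps makes the norms decrease from some index on, so they
converge to their infimum there. -/
theorem exists_tendsto_norm (x : PreLimit E) : ∃ r, Tendsto (fun i => ‖x.1 i‖) atTop (𝓝 r) := by
  obtain ⟨i, hx⟩ := x.2
  have hanti : ∀ j k, i ≤ j → j ≤ k → ‖x.1 k‖ ≤ ‖x.1 j‖ := fun j k hj hk => by
    rw [hx.mono hj k hk]
    exact norm_lin_le _ _
  have hbdd : BddBelow ((fun j => ‖x.1 j‖) '' Set.Ici i) :=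
    ⟨0, by rintro _ ⟨j, _, rfl⟩; exact norm_nonneg _⟩
  refine ⟨sInf ((fun j => ‖x.1 j‖) '' Set.Ici i), tendsto_order.2 ⟨fun a ha => ?_, fun a ha => ?_⟩⟩
  · filter_upwards [eventually_ge_atTop i] with j hj
    exact ha.trans_le (csInf_le hbdd ⟨j, hj, rfl⟩)
  · obtain ⟨_, ⟨j, hj, rfl⟩, hja⟩ := exists_lt_of_csInf_lt (Set.nonempty_Ici.image _) ha
    filter_upwards [eventually_ge_atTop j] with k hk
    exact (hanti j k hj hk).trans_lt hja

/-- The limit of the norms of the members of an eventually coherent family. -/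
noncomputable def limNorm (x : PreLimit E) : ℝ := (exists_tendsto_norm x).choose

theorem tendsto_limNorm (x : PreLimit E) : Tendsto (fun i => ‖x.1 i‖) atTop (𝓝 (limNorm x)) :=
  (exists_tendsto_norm x).choose_spec

theorem limNorm_mono {x y : PreLimit E} {i : I} (h : ∀ j, i ≤ j → ‖x.1 j‖ ≤ ‖y.1 j‖) :
    limNorm x ≤ limNorm y :=
  le_of_tendsto_of_tendsto (tendsto_limNorm x) (tendsto_limNorm y)
    ((eventually_ge_atTop i).mono h)

theorem limNorm_le {x : PreLimit E} {i : I} {r : ℝ} (h : ∀ j, i ≤ j → ‖x.1 j‖ ≤ r) :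
    limNorm x ≤ r :=
  le_of_tendsto (tendsto_limNorm x) ((eventually_ge_atTop i).mono h)

theorem limNorm_smul (r : ℝ) (x : PreLimit E) : limNorm (r • x) = ‖r‖ * limNorm x :=
  tendsto_nhds_unique (tendsto_limNorm _)
    (by simpa only [smul_apply, norm_smul] using (tendsto_limNorm x).const_mul ‖r‖)

theorem le_limNorm {x : PreLimit E} {i : I} {r : ℝ} (h : ∀ j, i ≤ j → r ≤ ‖x.1 j‖) :
    r ≤ limNorm x :=
  ge_of_tendsto (tendsto_limNorm x) ((eventually_ge_atTop i).mono h)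

variable (E) in
/-- `PreLimit.limNorm` as a seminorm. -/
noncomputable def addGroupSeminorm : AddGroupSeminorm (PreLimit E) where
  toFun := limNorm
  map_zero' := tendsto_nhds_unique (tendsto_limNorm _)
    (by simpa only [zero_apply, norm_zero] using tendsto_const_nhds)
  add_le' x y := le_of_tendsto_of_tendsto' (tendsto_limNorm _)
    ((tendsto_limNorm x).add (tendsto_limNorm y)) fun i => norm_add_le _ _
  neg' x := tendsto_nhds_unique (tendsto_limNorm _)
    (by simpa only [neg_apply, norm_neg] using tendsto_limNorm x)

noncomputable instance : SeminormedAddCommGroup (PreLimit E) :=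
  (addGroupSeminorm E).toSeminormedAddCommGroup

noncomputable instance : NormedSpace ℝ (PreLimit E) where
  norm_smul_le r x := (limNorm_smul r x).le

instance : HasSolidSeminorm (PreLimit E) where
  solid _ _ h := limNorm_mono (i := Classical.arbitrary I) fun j _ => HasSolidNorm.solid (h j)

open Classical in
variable (E) in
/-- The eventually coherent family generated by an element. -/
noncomputable def of (i : I) : E.obj i →ₗ[ℝ] PreLimit E where
  -- The value `0` at indices not above `i` is harmless: the seminorm sees only the tail of a
  -- family.
  toFun x := ⟨fun j => if h : i ≤ j then trans E h x else 0, i, fun j h => by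
    beta_reduce
    rw [dif_pos h, dif_pos le_rfl, trans_trans]⟩
  map_add' x y := Subtype.ext <| funext fun j => by
    change (if h : i ≤ j then trans E h (x + y) else 0) =
      (if h : i ≤ j then trans E h x else 0) + (if h : i ≤ j then trans E h y else 0)
    split_ifs <;> simp
  map_smul' r x := Subtype.ext <| funext fun j => by
    change (if h : i ≤ j then trans E h (r • x) else 0) =
      r • (if h : i ≤ j then trans E h x else 0)
    split_ifs <;> simp

theorem of_apply {i j : I} (h : i ≤ j) (x : E.obj i) : (of E i x).1 j = trans E h x := dif_pos h

theorem coherentFrom_of {i : I} (x : E.obj i) : CoherentFrom E (of E i x).1 i := fun j h => by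
  rw [of_apply h, of_apply le_rfl, trans_self]

open Classical in
theorem of_sup {i : I} (x y : E.obj i) : of E i (x ⊔ y) = of E i x ⊔ of E i y :=
  Subtype.ext <| funext fun j => by
    change (if h : i ≤ j then trans E h (x ⊔ y) else 0) =
      (if h : i ≤ j then trans E h x else 0) ⊔ (if h : i ≤ j then trans E h y else 0)
    split_ifs
    · exact lin_sup _ _ _
    · simp

open Classical in
theorem of_inf {i : I} (x y : E.obj i) : of E i (x ⊓ y) = of E i x ⊓ of E i y :=
  Subtype.ext <| funext fun j => by
    change (if h : i ≤ j then trans E h (x ⊓ y) else 0) =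
      (if h : i ≤ j then trans E h x else 0) ⊓ (if h : i ≤ j then trans E h y else 0)
    split_ifs
    · exact lin_inf _ _ _
    · simp

theorem norm_of_le {i : I} (x : E.obj i) : ‖of E i x‖ ≤ ‖x‖ :=
  limNorm_le (i := i) fun j h => by
    rw [of_apply h]
    exact norm_lin_le _ _

theorem norm_eq_zero_of_forall_ge {x : PreLimit E} {i : I} (h : ∀ j, i ≤ j → x.1 j = 0) :
    ‖x‖ = 0 :=
  le_antisymm (limNorm_le (i := i) fun j hj => by rw [h j hj, norm_zero]) (norm_nonneg x)

theorem norm_sub_of {x : PreLimit E} {i : I} (hx : CoherentFrom E x.1 i) :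
    ‖x - of E i (x.1 i)‖ = 0 :=
  norm_eq_zero_of_forall_ge (i := i) fun j h => by
    rw [sub_apply, of_apply h, hx j h, sub_self]

theorem norm_of_trans_sub_of {i j : I} (h : i ≤ j) (x : E.obj i) :
    ‖of E j (trans E h x) - of E i x‖ = 0 :=
  norm_eq_zero_of_forall_ge (i := j) fun k hk => by
    rw [sub_apply, of_apply hk, of_apply (h.trans hk), trans_trans, sub_self]

end PreLimit

end System

end BLAIPLH

namespace BLAIPLH

open UniformSpace

/-! ### Cocones with dense images -/

section Legs

variable {I : Type v} [Preorder I] {E : I ⥤ BLAIPLH.{max u v}}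

/-- The morphisms of a cocone. -/
def leg (s : Cocone E) (i : I) : E.obj i ⟶ s.pt := s.ι.app i

theorem lin_leg_trans (s : Cocone E) {i j : I} (h : i ≤ j) (x : E.obj i) :
    lin (leg s j) (trans E h x) = lin (leg s i) x := by
  rw [leg, leg, ← s.w (homOfLE h)]
  rfl

/-- The images of the members of the direct system are dense. -/
def HasDenseImages (s : Cocone E) : Prop :=
  ∀ y : s.pt, ∀ ε > 0, ∃ (i : I) (x : E.obj i), ‖y - lin (leg s i) x‖ < ε

theorem HasDenseImages.hom_ext {s : Cocone E} (hs : HasDenseImages s) {F : BLAIPLH.{max u v}}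
    {f g : s.pt ⟶ F} (h : ∀ i, s.ι.app i ≫ f = s.ι.app i ≫ g) : f = g := by
  refine BLAIPLH.hom_ext fun y => eq_of_norm_sub_le_zero (le_of_forall_pos_le_add fun ε hε => ?_)
  obtain ⟨i, x, hx⟩ := hs y (ε / 2) (half_pos hε)
  have h₀ : lin f (lin (leg s i) x) = lin g (lin (leg s i) x) := by
    rw [← lin_comp, leg, h i]
    rfl
  have h₁ := norm_lin_sub_le f y (lin (leg s i) x)
  have h₂ := norm_lin_sub_le g (lin (leg s i) x) y
  have h₃ := norm_sub_le_norm_sub_add_norm_sub (lin f y) (lin f (lin (leg s i) x)) (lin g y)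
  rw [norm_sub_rev (lin (leg s i) x) y] at h₂
  rw [h₀] at h₁ h₃
  linarith

end Legs

/-! ### The completed limit, its canonical maps and its universal property -/

section Limit

variable {I : Type v} [Preorder I] [IsDirectedOrder I] [Nonempty I] (E : I ⥤ BLAIPLH.{max u v})

/-- The completion of the seminormed space of eventually coherent families. -/
noncomputable def limitObj : BLAIPLH.{max u v} where
  carrier := Completion (PreLimit E)

/-- The canonical maps into the completion of the space of eventually coherent families. -/
noncomputable def toLimit (i : I) : E.obj i →ₗ[ℝ] limitObj E :=
  (Completion.toComplₗᵢ (𝕜 := ℝ) (E := PreLimit E)).toLinearMap ∘ₗ PreLimit.of E i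

variable {E}

theorem toLimit_apply (i : I) (x : E.obj i) :
    toLimit E i x = ((PreLimit.of E i x : PreLimit E) : Completion (PreLimit E)) := rfl

theorem coe_eq_coe_of_norm_sub_eq_zero {V : Type*} [SeminormedAddCommGroup V] {x y : V}
    (h : ‖x - y‖ = 0) : (x : Completion V) = y := by
  rw [← sub_eq_zero, ← norm_eq_zero, ← Completion.coe_sub, Completion.norm_coe, h]

theorem toLimit_trans {i j : I} (h : i ≤ j) (x : E.obj i) :
    toLimit E j (trans E h x) = toLimit E i x :=
  coe_eq_coe_of_norm_sub_eq_zero (PreLimit.norm_of_trans_sub_of h x)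

theorem toLimit_eq_coe {x : PreLimit E} {i : I} (hx : CoherentFrom E x.1 i) :
    toLimit E i (x.1 i) = (x : Completion (PreLimit E)) :=
  (coe_eq_coe_of_norm_sub_eq_zero (PreLimit.norm_sub_of hx)).symm

theorem toLimit_sup {i : I} (x y : E.obj i) :
    toLimit E i (x ⊔ y) = toLimit E i x ⊔ toLimit E i y := by
  rw [toLimit_apply, PreLimit.of_sup]
  exact Completion.coe_sup _ _

theorem toLimit_inf {i : I} (x y : E.obj i) :
    toLimit E i (x ⊓ y) = toLimit E i x ⊓ toLimit E i y := by
  rw [toLimit_apply, PreLimit.of_inf]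
  exact Completion.coe_inf _ _

theorem norm_toLimit_le {i : I} (x : E.obj i) : ‖toLimit E i x‖ ≤ ‖x‖ :=
  (Completion.norm_coe _).trans_le (PreLimit.norm_of_le x)

/-- The approximant can be taken beyond a prescribed index `i`, so that it can be compared with
elements coming from `E_i`. -/
theorem exists_norm_sub_toLimit_lt (i : I) (y : limitObj E) {ε : ℝ} (hε : 0 < ε) :
    ∃ j, i ≤ j ∧ ∃ x : E.obj j, ‖y - toLimit E j x‖ < ε := by
  obtain ⟨x, hx⟩ := Completion.denseRange_coe.exists_dist_lt (y : Completion (PreLimit E)) hε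
  obtain ⟨k, hk⟩ := x.exists_coherentFrom
  obtain ⟨j, hij, hkj⟩ := exists_ge_ge i k
  exact ⟨j, hij, x.1 j, by
    rw [toLimit_eq_coe (hk.mono hkj)]
    exact (dist_eq_norm _ _).symm.trans_lt hx⟩

/-- Truncation to `[0, x]` is nonexpansive and fixes `y`, so an approximant of `y` can be moved into
the interval without loss. -/
theorem norm_sub_clamp_le {F : BLAIPLH.{u}} {x y z : F} (hy : 0 ≤ y) (hyx : y ≤ x) :
    ‖y - (z ⊔ 0) ⊓ x‖ ≤ ‖y - z‖ := by
  calc ‖y - (z ⊔ 0) ⊓ x‖ = ‖(y ⊔ 0) ⊓ x - (z ⊔ 0) ⊓ x‖ := by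
        rw [sup_eq_left.2 hy, inf_eq_left.2 hyx]
    _ ≤ ‖y ⊔ 0 - z ⊔ 0‖ := norm_inf_sub_inf_le_norm _ _ _
    _ ≤ ‖y - z‖ := norm_sup_sub_sup_le_norm _ _ _

/-- Approximate `y` by an element of some `E_j` with `j ≥ i`, truncate it to the interval below the
image of `x` in `E_j`, and apply almost interval preservation of the connecting map. -/
theorem isAlmostIntervalPreserving_toLimit (i : I) : IsAlmostIntervalPreserving (toLimit E i) := by
  refine isAlmostIntervalPreserving_of_exists toLimit_sup fun x hx y hy hyx ε hε => ?_
  obtain ⟨j, hij, z, hz⟩ := exists_norm_sub_toLimit_lt i y (half_pos hε)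
  have htx : 0 ≤ trans E hij x := lin_nonneg _ hx
  obtain ⟨w, hw, hwx, hwz⟩ := exists_norm_sub_lin_lt (E.map (homOfLE hij)) hx
    (y := (z ⊔ 0) ⊓ trans E hij x) (le_inf le_sup_right htx) inf_le_right (half_pos hε)
  refine ⟨w, hw, hwx, ?_⟩
  have h₁ := norm_sub_clamp_le (z := toLimit E j z) hy hyx
  rw [← toLimit_trans hij x, ← map_zero (toLimit E j), ← toLimit_sup, ← toLimit_inf] at h₁
  have h₂ := norm_toLimit_le ((z ⊔ 0) ⊓ trans E hij x - trans E hij w)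
  rw [map_sub, toLimit_trans hij w] at h₂
  have h₃ := norm_sub_le_norm_sub_add_norm_sub y (toLimit E j ((z ⊔ 0) ⊓ trans E hij x))
    (toLimit E i w)
  have h₄ : ‖(z ⊔ 0) ⊓ trans E hij x - trans E hij w‖ < ε / 2 := hwz
  linarith

variable (E) in
/-- The canonical maps into the limit object, as morphisms. -/
noncomputable def toLimitHom (i : I) : E.obj i ⟶ limitObj E :=
  Hom.mk (toLimit E i) toLimit_sup toLimit_inf norm_toLimit_le
    (isAlmostIntervalPreserving_toLimit i)

variable (E) in
/-- The completion of the space of eventually coherent families, as a cocone. -/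
noncomputable def limitCocone : Cocone E where
  pt := limitObj E
  ι :=
    { app := toLimitHom E
      naturality := fun _ _ f => hom_ext fun x => toLimit_trans (leOfHom f) x }

namespace PreLimit

variable (s : Cocone E)

/-- The value at an eventually coherent family of the map induced by a cocone. -/
noncomputable def descFun (x : PreLimit E) : s.pt :=
  lin (leg s x.exists_coherentFrom.choose) (x.1 x.exists_coherentFrom.choose)

/-- The chosen index is immaterial: compare with the given one at a common upper bound. -/
theorem descFun_eq {x : PreLimit E} {i : I} (hx : CoherentFrom E x.1 i) :
    descFun s x = lin (leg s i) (x.1 i) := by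
  obtain ⟨k, h₁, h₂⟩ := exists_ge_ge x.exists_coherentFrom.choose i
  rw [← lin_leg_trans s h₂, ← hx k h₂, x.exists_coherentFrom.choose_spec k h₁, lin_leg_trans s h₁]
  rfl

/-- The map on eventually coherent families induced by a cocone, as a linear map. -/
noncomputable def desc : PreLimit E →ₗ[ℝ] s.pt where
  toFun := descFun s
  map_add' x y := by
    obtain ⟨i, hx, hy⟩ := exists_coherentFrom₂ x y
    have hxy : CoherentFrom E (x + y).1 i := fun j h => by
      rw [add_apply, add_apply, map_add, hx j h, hy j h]
    rw [descFun_eq s hx, descFun_eq s hy, descFun_eq s hxy, add_apply]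
    exact map_add _ _ _
  map_smul' r x := by
    obtain ⟨i, hx⟩ := x.exists_coherentFrom
    have hrx : CoherentFrom E (r • x).1 i := fun j h => by
      rw [smul_apply, smul_apply, map_smul, hx j h]
    rw [descFun_eq s hx, descFun_eq s hrx, smul_apply]
    exact map_smul _ _ _

theorem desc_eq {x : PreLimit E} {i : I} (hx : CoherentFrom E x.1 i) :
    desc s x = lin (leg s i) (x.1 i) := descFun_eq s hx

theorem desc_of {i : I} (x : E.obj i) : desc s (of E i x) = lin (leg s i) x := by
  rw [desc_eq s (coherentFrom_of x), of_apply le_rfl, trans_self]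

theorem desc_sup (x y : PreLimit E) : desc s (x ⊔ y) = desc s x ⊔ desc s y := by
  obtain ⟨i, hx, hy⟩ := exists_coherentFrom₂ x y
  have hxy : CoherentFrom E (x ⊔ y).1 i := fun j h => by
    rw [sup_apply, sup_apply, hx j h, hy j h]
    exact (lin_sup _ _ _).symm
  rw [desc_eq s hx, desc_eq s hy, desc_eq s hxy, sup_apply]
  exact lin_sup _ _ _

theorem desc_inf (x y : PreLimit E) : desc s (x ⊓ y) = desc s x ⊓ desc s y := by
  obtain ⟨i, hx, hy⟩ := exists_coherentFrom₂ x y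
  have hxy : CoherentFrom E (x ⊓ y).1 i := fun j h => by
    rw [inf_apply, inf_apply, hx j h, hy j h]
    exact (lin_inf _ _ _).symm
  rw [desc_eq s hx, desc_eq s hy, desc_eq s hxy, inf_apply]
  exact lin_inf _ _ _

theorem norm_desc_le (x : PreLimit E) : ‖desc s x‖ ≤ ‖x‖ := by
  obtain ⟨i, hx⟩ := x.exists_coherentFrom
  refine le_limNorm (i := i) fun j h => ?_
  rw [desc_eq s (hx.mono h)]
  exact norm_lin_le _ _

theorem uniformContinuous_desc : UniformContinuous (desc s) :=
  AddMonoidHomClass.uniformContinuous_of_bound (desc s) 1 fun x => by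
    rw [one_mul]; exact norm_desc_le s x

end PreLimit

variable (s : Cocone E)

/-- The map on the limit object induced by a cocone. -/
noncomputable def limitDescFun : Completion (PreLimit E) → s.pt :=
  Completion.extension (PreLimit.desc s)

theorem continuous_limitDescFun : Continuous (limitDescFun s) := Completion.continuous_extension

theorem limitDescFun_coe (x : PreLimit E) :
    limitDescFun s (x : Completion (PreLimit E)) = PreLimit.desc s x :=
  Completion.extension_coe (PreLimit.uniformContinuous_desc s) x

theorem limitDescFun_add (x y : Completion (PreLimit E)) :
    limitDescFun s (x + y) = limitDescFun s x + limitDescFun s y := by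
  have hc := continuous_limitDescFun s
  refine Completion.induction_on₂ x y (isClosed_eq (by fun_prop) (by fun_prop)) fun x y => ?_
  rw [← Completion.coe_add, limitDescFun_coe, limitDescFun_coe, limitDescFun_coe, map_add]

theorem limitDescFun_smul (r : ℝ) (x : Completion (PreLimit E)) :
    limitDescFun s (r • x) = r • limitDescFun s x := by
  have hc := continuous_limitDescFun s
  refine Completion.induction_on x (isClosed_eq (hc.comp (continuous_const_smul r))
    (hc.const_smul r)) fun x => ?_
  rw [← Completion.coe_smul, limitDescFun_coe, limitDescFun_coe, map_smul]

theorem limitDescFun_sup (x y : Completion (PreLimit E)) :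
    limitDescFun s (x ⊔ y) = limitDescFun s x ⊔ limitDescFun s y := by
  have hc := continuous_limitDescFun s
  refine Completion.induction_on₂ x y (isClosed_eq (by fun_prop) (by fun_prop)) fun x y => ?_
  rw [← Completion.coe_sup, limitDescFun_coe, limitDescFun_coe, limitDescFun_coe,
    PreLimit.desc_sup]

theorem limitDescFun_inf (x y : Completion (PreLimit E)) :
    limitDescFun s (x ⊓ y) = limitDescFun s x ⊓ limitDescFun s y := by
  have hc := continuous_limitDescFun s
  refine Completion.induction_on₂ x y (isClosed_eq (by fun_prop) (by fun_prop)) fun x y => ?_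
  rw [← Completion.coe_inf, limitDescFun_coe, limitDescFun_coe, limitDescFun_coe,
    PreLimit.desc_inf]

theorem norm_limitDescFun_le (x : Completion (PreLimit E)) : ‖limitDescFun s x‖ ≤ ‖x‖ := by
  have hc := continuous_limitDescFun s
  refine Completion.induction_on x (isClosed_le (by fun_prop) (by fun_prop)) fun x => ?_
  rw [limitDescFun_coe, Completion.norm_coe]
  exact PreLimit.norm_desc_le s x

/-- The map on the limit object induced by a cocone, as a linear map. -/
noncomputable def limitDesc : limitObj E →ₗ[ℝ] s.pt where
  toFun := limitDescFun s
  map_add' := limitDescFun_add s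
  map_smul' := limitDescFun_smul s

theorem limitDesc_toLimit {i : I} (x : E.obj i) :
    limitDesc s (toLimit E i x) = lin (leg s i) x :=
  (limitDescFun_coe s _).trans (PreLimit.desc_of s x)

theorem limitDesc_sup (x y : limitObj E) :
    limitDesc s (x ⊔ y) = limitDesc s x ⊔ limitDesc s y := limitDescFun_sup s x y

theorem limitDesc_inf (x y : limitObj E) :
    limitDesc s (x ⊓ y) = limitDesc s x ⊓ limitDesc s y := limitDescFun_inf s x y

theorem norm_limitDesc_le (x : limitObj E) : ‖limitDesc s x‖ ≤ ‖x‖ := norm_limitDescFun_le s x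

/-- Replace `x` by a nearby positive element coming from some `E_i`, where the cocone map already
preserves intervals approximately, and truncate at both ends to correct for the replacement. -/
theorem isAlmostIntervalPreserving_limitDesc : IsAlmostIntervalPreserving (limitDesc s) := by
  refine isAlmostIntervalPreserving_of_exists (limitDesc_sup s) fun x hx y hy hyx ε hε => ?_
  have hε₃ : 0 < ε / 3 := by positivity
  obtain ⟨i, -, z, hz⟩ := exists_norm_sub_toLimit_lt (Classical.arbitrary I) x hε₃
  set z' : E.obj i := z ⊔ 0 with hz'
  have hxz' : ‖x - toLimit E i z'‖ < ε / 3 := by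
    refine lt_of_le_of_lt ?_ hz
    calc ‖x - toLimit E i z'‖ = ‖x ⊔ 0 - toLimit E i z ⊔ 0‖ := by
          rw [sup_eq_left.2 hx, hz', toLimit_sup, map_zero]
      _ ≤ ‖x - toLimit E i z‖ := norm_sup_sub_sup_le_norm _ _ _
  have hz'0 : 0 ≤ z' := le_sup_right
  obtain ⟨w, hw, hwz, hyw⟩ := exists_norm_sub_lin_lt (s.ι.app i) hz'0
    (y := y ⊓ lin (leg s i) z') (le_inf hy (lin_nonneg _ hz'0)) inf_le_right hε₃
  have hpos := (isAlmostIntervalPreserving_toLimit (E := E) i).1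
  -- `w ≤ z'` bounds the image of `w` only by that of `z'`, which need not lie below `x`. The cut by
  -- `x` costs at most the distance of these two.
  refine ⟨toLimit E i w ⊓ x, le_inf (hpos w hw) hx, inf_le_right, ?_⟩
  have h₁ : ‖y - y ⊓ lin (leg s i) z'‖ ≤ ‖x - toLimit E i z'‖ := by
    rw [← limitDesc_toLimit]
    calc ‖y - y ⊓ limitDesc s (toLimit E i z')‖
        = ‖limitDesc s x ⊓ y - limitDesc s (toLimit E i z') ⊓ y‖ := by
          rw [inf_eq_right.2 hyx, inf_comm y]
      _ ≤ ‖limitDesc s x - limitDesc s (toLimit E i z')‖ := norm_inf_sub_inf_le_norm _ _ _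
      _ ≤ ‖x - toLimit E i z'‖ := by rw [← map_sub]; exact norm_limitDesc_le s _
  have h₂ : ‖lin (leg s i) w - limitDesc s (toLimit E i w ⊓ x)‖ ≤ ‖x - toLimit E i z'‖ := by
    rw [← limitDesc_toLimit, ← map_sub]
    refine (norm_limitDesc_le s _).trans ?_
    have hle : toLimit E i w ≤ toLimit E i z' := by
      have := hpos (z' - w) (sub_nonneg.2 hwz)
      rwa [map_sub, sub_nonneg] at this
    calc ‖toLimit E i w - toLimit E i w ⊓ x‖
        = ‖toLimit E i z' ⊓ toLimit E i w - x ⊓ toLimit E i w‖ := by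
          rw [inf_eq_right.2 hle, inf_comm x]
      _ ≤ ‖toLimit E i z' - x‖ := norm_inf_sub_inf_le_norm _ _ _
      _ = ‖x - toLimit E i z'‖ := norm_sub_rev _ _
  have h₃ := norm_sub_le_norm_sub_add_norm_sub y (y ⊓ lin (leg s i) z') (lin (leg s i) w)
  have h₄ := norm_sub_le_norm_sub_add_norm_sub y (lin (leg s i) w)
    (limitDesc s (toLimit E i w ⊓ x))
  have h₅ : ‖y ⊓ lin (leg s i) z' - lin (leg s i) w‖ < ε / 3 := hyw
  linarith

/-- The map on the limit object induced by a cocone, as a morphism. -/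
noncomputable def limitDescHom : limitObj E ⟶ s.pt :=
  Hom.mk (limitDesc s) (limitDesc_sup s) (limitDesc_inf s) (norm_limitDesc_le s)
    (isAlmostIntervalPreserving_limitDesc s)

variable (E) in
theorem hasDenseImages_limitCocone : HasDenseImages (limitCocone E) := fun y ε hε => by
  obtain ⟨i, -, x, hx⟩ := exists_norm_sub_toLimit_lt (Classical.arbitrary I) y hε
  exact ⟨i, x, hx⟩

variable (E) in
/-- The completion of the space of eventually coherent families is a direct limit. -/
noncomputable def isColimitLimitCocone : IsColimit (limitCocone E) where
  desc := limitDescHom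
  fac s _ := BLAIPLH.hom_ext fun x => limitDesc_toLimit s x
  uniq s _ hm := (hasDenseImages_limitCocone E).hom_ext fun i =>
    (hm i).trans (BLAIPLH.hom_ext fun x => (limitDesc_toLimit s x).symm)

/-- The comparison morphism from the constructed limit is contractive and inverts the one into it,
so it carries approximations back. -/
theorem hasDenseImages_of_isColimit {s : Cocone E} (hs : IsColimit s) : HasDenseImages s := by
  intro y ε hε
  obtain ⟨i, x, hx⟩ := hasDenseImages_limitCocone E (lin (hs.desc (limitCocone E)) y) ε hε
  refine ⟨i, x, lt_of_le_of_lt ?_ hx⟩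
  set g := (isColimitLimitCocone E).desc s
  have h₁ : lin g (lin (hs.desc (limitCocone E)) y) = y := by
    have : hs.desc (limitCocone E) ≫ g = 𝟙 s.pt := hs.hom_ext fun j => by
      rw [hs.fac_assoc, (isColimitLimitCocone E).fac, Category.comp_id]
    rw [← lin_comp, this, lin_id]
  have h₂ : lin g (lin (leg (limitCocone E) i) x) = lin (leg s i) x := by
    rw [leg, leg, ← (isColimitLimitCocone E).fac s i]
    rfl
  have := norm_lin_sub_le g (lin (hs.desc (limitCocone E)) y) (lin (leg (limitCocone E) i) x)
  rwa [h₁, h₂] at this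

end Limit

end BLAIPLH

/-! ### Order continuity through increasing sequences in order intervals -/

section OrderContinuity

/-- Increasing sequences in the order interval `[0, x]` are norm Cauchy. -/
def MonotoneCauchyBelow {E : Type*} [NormedAddCommGroup E] [Lattice E] (x : E) : Prop :=
  ∀ s : ℕ → E, Monotone s → (∀ n, 0 ≤ s n) → (∀ n, s n ≤ x) → CauchySeq s

variable {E : Type u} [NormedAddCommGroup E] [Lattice E] [IsOrderedAddMonoid E] [HasSolidNorm E]

theorem norm_le_norm_of_nonneg_of_le {x y : E} (hx : 0 ≤ x) (hxy : x ≤ y) : ‖x‖ ≤ ‖y‖ :=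
  norm_le_norm_of_abs_le_abs (by rwa [abs_of_nonneg hx, abs_of_nonneg (hx.trans hxy)])

theorem eq_zero_of_forall_nsmul_le [NormedSpace ℝ E] {x y : E} (hx : 0 ≤ x) (h : ∀ n : ℕ, n • x ≤ y) : x = 0 := by
  by_contra hne
  have hpos : 0 < ‖x‖ := norm_pos_iff.2 hne
  obtain ⟨n, hn⟩ := exists_nat_gt (‖y‖ / ‖x‖)
  have h₁ := norm_le_norm_of_nonneg_of_le (nsmul_nonneg hx n) (h n)
  rw [← Nat.cast_smul_eq_nsmul ℝ, norm_smul, Real.norm_natCast] at h₁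
  rw [div_lt_iff₀ hpos] at hn
  linarith

/-- In a Banach lattice with order continuous norm, increasing order bounded sequences are
Cauchy. -/
theorem IsOrderContinuousNorm.monotoneCauchyBelow [NormedSpace ℝ E]
    (hE : IsOrderContinuousNorm E) (x : E) : MonotoneCauchyBelow x := by
  intro s hs h0 hx
  -- The net of differences between upper bounds of `s` and terms of `s` decreases to `0` even if
  -- `s` has no supremum.
  let D := (upperBounds (Set.range s))ᵒᵈ × ℕ
  let d : D → E := fun p => (OrderDual.ofDual p.1).1 - s p.2
  have hxub : x ∈ upperBounds (Set.range s) := by rintro _ ⟨n, rfl⟩; exact hx n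
  have : Nonempty D := ⟨(OrderDual.toDual ⟨x, hxub⟩, 0)⟩
  have : IsDirectedOrder (upperBounds (Set.range s))ᵒᵈ := ⟨fun a b =>
    ⟨OrderDual.toDual ⟨(OrderDual.ofDual a).1 ⊓ (OrderDual.ofDual b).1, by
      rintro _ ⟨n, rfl⟩
      exact le_inf ((OrderDual.ofDual a).2 ⟨n, rfl⟩) ((OrderDual.ofDual b).2 ⟨n, rfl⟩)⟩,
      (inf_le_left : (OrderDual.ofDual a).1 ⊓ (OrderDual.ofDual b).1 ≤ (OrderDual.ofDual a).1),
      (inf_le_right : (OrderDual.ofDual a).1 ⊓ (OrderDual.ofDual b).1 ≤ (OrderDual.ofDual b).1)⟩⟩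
  have : IsDirectedOrder D := ⟨fun a b => by
    obtain ⟨c, hac, hbc⟩ := exists_ge_ge a.1 b.1
    exact ⟨(c, max a.2 b.2), ⟨hac, le_max_left _ _⟩, ⟨hbc, le_max_right _ _⟩⟩⟩
  have hd : Antitone d := fun a b h => sub_le_sub h.1 (hs h.2)
  have hglb : IsGLB (Set.range d) 0 := by
    refine ⟨?_, fun z hz => ?_⟩
    · rintro _ ⟨p, rfl⟩
      exact sub_nonneg.2 ((OrderDual.ofDual p.1).2 ⟨p.2, rfl⟩)
    -- Subtracting `z ⊔ 0` from an upper bound gives an upper bound. Iterating from `x` bounds all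
    -- multiples of `z ⊔ 0` by `x`, so it vanishes by the Archimedean property.
    · have hz' : ∀ y ∈ upperBounds (Set.range s), y - z ⊔ 0 ∈ upperBounds (Set.range s) := by
        rintro y hy _ ⟨n, rfl⟩
        have h₁ : z ≤ y - s n := hz ⟨(OrderDual.toDual ⟨y, hy⟩, n), rfl⟩
        have h₂ : z ⊔ 0 ≤ y - s n := sup_le h₁ (sub_nonneg.2 (hy ⟨n, rfl⟩))
        exact le_sub_comm.1 h₂
      have hk : ∀ k : ℕ, x - k • (z ⊔ 0) ∈ upperBounds (Set.range s) := fun k => by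
        induction k with
        | zero => simpa using hxub
        | succ k ih => rw [succ_nsmul, ← sub_sub]; exact hz' _ ih
      have h0' : z ⊔ 0 = 0 := eq_zero_of_forall_nsmul_le (y := x) le_sup_right fun k =>
        sub_nonneg.1 ((h0 0).trans (hk k ⟨0, rfl⟩))
      exact sup_eq_right.1 h0'
  have hlim := hE D d hd hglb
  refine Metric.cauchySeq_iff'.2 fun ε hε => ?_
  obtain ⟨p, hp⟩ := (hlim.eventually_lt_const hε).exists
  refine ⟨p.2, fun n hn => ?_⟩
  rw [dist_eq_norm]
  refine lt_of_le_of_lt (norm_le_norm_of_nonneg_of_le (sub_nonneg.2 (hs hn)) ?_) hp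
  exact sub_le_sub_right ((OrderDual.ofDual p.1).2 ⟨n, rfl⟩) _

theorem cauchySeq_of_forall_exists_norm_sub_le {F : Type*} [SeminormedAddCommGroup F] {s : ℕ → F}
    (h : ∀ ε > 0, ∃ t : ℕ → F, CauchySeq t ∧ ∀ n, ‖s n - t n‖ ≤ ε) : CauchySeq s := by
  refine Metric.cauchySeq_iff'.2 fun ε hε => ?_
  have hε₄ : 0 < ε / 4 := by positivity
  obtain ⟨t, ht, hst⟩ := h (ε / 4) hε₄
  obtain ⟨N, hN⟩ := Metric.cauchySeq_iff'.1 ht (ε / 4) hε₄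
  refine ⟨N, fun n hn => ?_⟩
  have h₁ := hst n
  have h₂ := hst N
  have h₃ := hN n hn
  rw [← dist_eq_norm] at h₁ h₂
  have h₄ := dist_triangle4_right (s n) (s N) (t n) (t N)
  linarith

/-- A decreasing net that is not Cauchy has an increasing sequence of indices `a n` with jumps of
size at least `ε`; then `x (a 0) - x (a n)` increases in `[0, x (a 0)]` without being Cauchy. So the
net converges, and its limit is its infimum. -/
theorem isOrderContinuousNorm_of_monotoneCauchyBelow [CompleteSpace E]
    (h : ∀ x : E, MonotoneCauchyBelow x) : IsOrderContinuousNorm E := by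
  intro A _ _ _ x hx hglb
  have key : ∀ ε > 0, ∃ a, ∀ b, a ≤ b → ‖x a - x b‖ < ε := by
    by_contra! hcon
    obtain ⟨ε, hε, hcon⟩ := hcon
    choose f hf hfε using hcon
    let a : ℕ → A := fun n => f^[n] (Classical.arbitrary A)
    have ha : ∀ n, a (n + 1) = f (a n) := fun n => Function.iterate_succ_apply' _ _ _
    have hmono : Monotone a := monotone_nat_of_le_succ fun n => by rw [ha]; exact hf _
    have hc : CauchySeq fun n => x (a 0) - x (a n) :=
      h (x (a 0)) _ (fun m n hmn => sub_le_sub_left (hx (hmono hmn)) _)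
        (fun n => sub_nonneg.2 (hx (hmono (Nat.zero_le n))))
        (fun n => sub_le_self _ (hglb.1 ⟨_, rfl⟩))
    obtain ⟨N, hN⟩ := Metric.cauchySeq_iff.1 hc ε hε
    have h₁ := hN (N + 1) (Nat.le_succ N) N le_rfl
    rw [dist_eq_norm, sub_sub_sub_cancel_left, ha] at h₁
    exact absurd h₁ (not_lt.2 (hfε _))
  have hc : Cauchy (map x atTop) := by
    refine Metric.cauchy_iff.2 ⟨inferInstance, fun ε hε => ?_⟩
    obtain ⟨a, ha⟩ := key (ε / 2) (half_pos hε)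
    refine ⟨x '' Set.Ici a, image_mem_map (Ici_mem_atTop a), ?_⟩
    rintro _ ⟨b, hb, rfl⟩ _ ⟨c, hc, rfl⟩
    have h₁ := ha b hb
    have h₂ := ha c hc
    rw [← dist_eq_norm] at h₁ h₂
    have h₃ := dist_triangle_left (x b) (x c) (x a)
    linarith
  obtain ⟨y, hy⟩ := CompleteSpace.complete hc
  have hy' : Tendsto x atTop (𝓝 y) := hy
  have h0 : y = 0 := (isGLB_of_tendsto_atTop hx hy').unique hglb
  simpa [h0] using hy'.norm

/-- Cutting a sequence below `x` by `y` moves all its terms by at most `‖x - y‖`, and a uniform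
limit of Cauchy sequences is Cauchy. -/
theorem MonotoneCauchyBelow.of_forall_exists_norm_sub_lt {x : E}
    (h : ∀ ε > 0, ∃ y, 0 ≤ y ∧ MonotoneCauchyBelow y ∧ ‖x - y‖ < ε) : MonotoneCauchyBelow x := by
  intro s hs h0 hx
  refine cauchySeq_of_forall_exists_norm_sub_le fun ε hε => ?_
  obtain ⟨y, hy0, hy, hxy⟩ := h ε hε
  refine ⟨fun n => s n ⊓ y, hy _ (fun m n hmn => inf_le_inf_right _ (hs hmn))
    (fun n => le_inf (h0 n) hy0) (fun n => inf_le_right), fun n => ?_⟩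
  calc ‖s n - s n ⊓ y‖ = ‖x ⊓ s n - y ⊓ s n‖ := by rw [inf_eq_right.2 (hx n), inf_comm y]
    _ ≤ ‖x - y‖ := norm_inf_sub_inf_le_norm _ _ _
    _ ≤ ε := hxy.le

theorem norm_partialSups_sub_le (s t : ℕ → E) (n : ℕ) :
    ‖partialSups s n - partialSups t n‖ ≤ ∑ k ∈ Finset.range (n + 1), ‖s k - t k‖ := by
  induction n with
  | zero => simp
  | succ n ih =>
    rw [partialSups_add_one, partialSups_add_one, Finset.sum_range_succ]
    exact (norm_sup_sub_sup_le_add_norm _ _ _ _).trans (add_le_add_left ih _)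

namespace BLAIPLH

theorem lin_partialSups {E F : BLAIPLH.{u}} (f : E ⟶ F) (s : ℕ → E) (n : ℕ) :
    lin f (partialSups s n) = partialSups (fun k => lin f (s k)) n := by
  induction n with
  | zero => simp
  | succ n ih => rw [partialSups_add_one, partialSups_add_one, lin_sup, ih]

/-- Approximate lifts of the terms to `[0, x]` need not increase, but their partial suprema do and
stay in `[0, x]`. Since `s` equals its own partial suprema, the error is at most the sum of the
individual errors. -/
theorem monotoneCauchyBelow_lin {E F : BLAIPLH.{u}} (f : E ⟶ F) {x : E} (hx : 0 ≤ x)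
    (h : MonotoneCauchyBelow x) : MonotoneCauchyBelow (lin f x) := by
  intro s hs h0 hsx
  refine cauchySeq_of_forall_exists_norm_sub_le fun ε hε => ?_
  -- The tolerances `ε / 2 / 2 ^ n` sum to `ε`.
  choose z hz0 hzx hz using fun n =>
    exists_norm_sub_lin_lt f hx (h0 n) (hsx n) (ε := ε / 2 / 2 ^ n) (by positivity)
  have hcauchy : CauchySeq (partialSups z) := h _ (partialSups z).monotone
    (fun n => (hz0 n).trans (le_partialSups z n)) (fun n => partialSups_le z n x fun k _ => hzx k)
  refine ⟨fun n => lin f (partialSups z n), ?_, fun n => ?_⟩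
  · refine Metric.cauchySeq_iff'.2 fun δ hδ => ?_
    obtain ⟨N, hN⟩ := Metric.cauchySeq_iff'.1 hcauchy δ hδ
    refine ⟨N, fun n hn => ?_⟩
    have := hN n hn
    rw [dist_eq_norm] at this ⊢
    exact (norm_lin_sub_le f _ _).trans_lt this
  · have h₁ := norm_partialSups_sub_le s (fun k => lin f (z k)) n
    rw [← lin_partialSups, hs.partialSups_eq] at h₁
    refine h₁.trans ((Finset.sum_le_sum fun k _ => (hz k).le).trans ?_)
    exact (summable_geometric_two' ε).sum_le_tsum _ (fun k _ => by positivity) |>.trans_eq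
      (tsum_geometric_two' ε)

variable {I : Type v} [Preorder I] {E : I ⥤ BLAIPLH.{max u v}}

theorem HasDenseImages.isOrderContinuousNorm {s : Cocone E}
    (hs : HasDenseImages s) (hE : ∀ i, IsOrderContinuousNorm (E.obj i)) :
    IsOrderContinuousNorm s.pt := by
  -- The sequence is introduced first because `0 ≤ t 0 ≤ x` supplies the positivity of `x` needed
  -- below.
  refine isOrderContinuousNorm_of_monotoneCauchyBelow fun x t ht h0 hx => ?_
  refine MonotoneCauchyBelow.of_forall_exists_norm_sub_lt (fun ε hε => ?_) t ht h0 hx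
  obtain ⟨i, z, hz⟩ := hs x ε hε
  have hz0 : (0 : E.obj i) ≤ z ⊔ 0 := le_sup_right
  refine ⟨lin (leg s i) (z ⊔ 0), lin_nonneg _ hz0,
    monotoneCauchyBelow_lin _ hz0 ((hE i).monotoneCauchyBelow _), lt_of_le_of_lt ?_ hz⟩
  calc ‖x - lin (leg s i) (z ⊔ 0)‖ = ‖x ⊔ 0 - lin (leg s i) z ⊔ 0‖ := by
        rw [lin_sup, map_zero, sup_eq_left.2 ((h0 0).trans (hx 0))]
    _ ≤ ‖x - lin (leg s i) z‖ := norm_sup_sub_sup_le_norm _ _ _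

end BLAIPLH

end OrderContinuity

theorem mainTheorem5 {I : Type v} [Preorder I] [IsDirectedOrder I] [Nonempty I]
    (E : I ⥤ BLAIPLH.{max u v}) :
    (∃ c : Cocone E, Nonempty (IsColimit c)) ∧
      ((∀ i : I, IsOrderContinuousNorm (E.obj i)) →
        ∀ c : Cocone E, IsColimit c → IsOrderContinuousNorm c.pt) :=
  ⟨⟨BLAIPLH.limitCocone E, ⟨BLAIPLH.isColimitLimitCocone E⟩⟩,
    fun hE _ hc => (BLAIPLH.hasDenseImages_of_isColimit hc).isOrderContinuousNorm hE⟩
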